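/- Let $\mathbb D=\{z\in\mathbb C:|z|<1\}$, $\mathbb T=\partial\mathbb D$, and let $F:\overline{\mathbb D}\to\mathbb R^3$ be of class $C^1$ on the closed disk. Suppose that $F|_{\mathbb D}$ is a conformal minimal immersion (that is, $F$ is harmonic in $\mathbb D$ and, with $z=x+iy$, $|F_x|=|F_y|>0$ and $F_x\perp F_y$ in $\mathbb D$), that $F(\mathbb T)$ is contained in the unit sphere $\mathbb S^2$, and that the unit normals of $F$ lie in a half-sphere: there is a unit vector $e\in\mathbb R^3$ with $\langle e,\mathbf n(z)\rangle\ge 0$ for all $z\in\mathbb D$, where $\mathbf n=F_x\times F_y/|F_x\times F_y|$. Then $|F(0)|<1$ and $$|dF(z)|\ \ge\ \frac12\,\frac{1-|F(0)|}{1+|F(0)|}\qquad\text{for every } z\in\mathbb D,$$ where $|dF(z)|$ is the operator norm of the differential. Consequently $F^{-1}$ is Lipschitz from the surface $\Sigma$ parametrized by $F$ over $\mathbb D$, with its intrinsic metric, to $\mathbb D$ with the Euclidean metric: $$|z-w|\ \le\ 2\,\frac{1+|F(0)|}{1-|F(0)|}\; d_\Sigma\big(F(z),F(w)\big)\qquad\text{for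 all } z,w\in\mathbb D.$$ Here $d_\Sigma(F(z),F(w))$ is the infimum of the lengths of the curves $F\circ\gamma$ over all $C^1$ curves $\gamma:[0,1]\to\mathbb D$ from $z$ to $w$ (the points of the immersed surface $\Sigma$ being distinguished by their parameters when $F$ is not injective). -/

import Mathlib

open Set Metric MeasureTheory

noncomputable section

/-- Euclidean three-space. -/
abbrev E3 : Type := EuclideanSpace ℝ (Fin 3)

/-- The open unit disk in the plane. -/
def unitDisk : Set ℂ := ball (0 : ℂ) 1

/-- `F` is a conformal minimal immersion of the open unit disk into `ℝ³`: it is harmonic, and at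
every point its real differential is a nonzero multiple of a linear isometry (so `F` is an
immersion, with `|F_x| = |F_y| ≠ 0` and `F_x ⊥ F_y`). -/
structure IsConformalMinimalImmersion (F : ℂ → E3) : Prop where
  harmonic : InnerProductSpace.HarmonicOnNhd F unitDisk
  conformal : ∀ z ∈ unitDisk, ConformalAt F z

/-- The vector product on Euclidean three-space. -/
def cross3 (a b : E3) : E3 := WithLp.toLp 2 (crossProduct (WithLp.ofLp a) (WithLp.ofLp b))

/-- The Gauss map: the unit normal `F_x × F_y / |F_x × F_y|` of the surface at the point with
parameter `z = x + i y`. -/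
def unitNormal (F : ℂ → E3) (z : ℂ) : E3 :=
  let N := cross3 (fderiv ℝ F z 1) (fderiv ℝ F z Complex.I)
  ‖N‖⁻¹ • N

/-- The unit normals of `F` over the open unit disk lie in one (closed) half-sphere. -/
def NormalsInHalfSphere (F : ℂ → E3) : Prop :=
  ∃ e : E3, ‖e‖ = 1 ∧ ∀ z ∈ unitDisk, 0 ≤ inner ℝ e (unitNormal F z)

/-- `γ`, restricted to `[0,1]`, is a `C¹` curve in the open unit disk from `z` to `w`. -/
structure IsDiskCurve (γ : ℝ → ℂ) (z w : ℂ) : Prop where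
  contDiffOn : ContDiffOn ℝ 1 γ (Icc 0 1)
  mapsTo : MapsTo γ (Icc 0 1) unitDisk
  source : γ 0 = z
  target : γ 1 = w

/-- The length in `ℝ³` of the curve `F ∘ γ` on the surface. -/
def surfaceLength (F : ℂ → E3) (γ : ℝ → ℂ) : ℝ :=
  ∫ t in (0 : ℝ)..1, ‖derivWithin (F ∘ γ) (Icc 0 1) t‖

/-- The intrinsic distance, on the immersed surface parametrized by `F` over the open unit disk,
between the points with parameters `z` and `w`: the infimum of the lengths of the `C¹` curves on
the surface that join them. -/
def intrinsicDist (F : ℂ → E3) (z w : ℂ) : ℝ :=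
  sInf {L : ℝ | ∃ γ : ℝ → ℂ, IsDiskCurve γ z w ∧ L = surfaceLength F γ}

end

/-! The half-sphere condition makes the conformal factor `√c` comparable to the modulus of a
zero-free holomorphic function: with `u` a unit vector orthogonal to `e`, `g = ⟪F_x - i F_y, u + i e
× u⟫` satisfies `√c ≤ |g| ≤ 2√c`. The maximum principle for `1/g` then carries a lower bound for
`|dF|` from the circle into the disk at the cost of a factor 2 (`le_conformalFactor`).

The bound on the circle is a quantitative Hopf lemma (`boundary_schwarz`). The function `⟪F ζ, F⟫`
reaches its maximum 1 at `ζ`, and a Schwarz-Pick inequality, integrated along the radius to `ζ`,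
controls how fast it gets there. For conformal harmonic maps into the ball this inequality has the
same form as for holomorphic functions (`IsConformalMinimalImmersion.schwarzPick`). It follows from
a planar version for the projection of `F` to a suitable plane, where conformality bounds one
partial derivative by the other. Integrating the bound on `dF` along curves gives the Lipschitz
estimate. -/

/-! ### Schwarz-Pick for planar harmonic maps. -/

/-- Maximum modulus for `exp (-L)`, whose norm is `exp (-Re L)`. -/
theorem re_nonneg_of_forall_sphere {L : ℂ → ℂ} {r : ℝ} (hr : 0 < r)
    (hL : DiffContOnCl ℂ L (ball 0 r)) (h : ∀ z ∈ sphere (0 : ℂ) r, 0 ≤ (L z).re) :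
    0 ≤ (L 0).re := by
  have hd : DiffContOnCl ℂ (fun z => Complex.exp (-L z)) (ball 0 r) :=
    Complex.differentiable_exp.comp_diffContOnCl hL.neg
  have h1 : ‖Complex.exp (-L 0)‖ ≤ 1 := by
    refine Complex.norm_le_of_forall_mem_frontier_norm_le isBounded_ball hd (fun z hz => ?_)
      (subset_closure (mem_ball_self hr))
    rw [frontier_ball _ hr.ne'] at hz
    simpa [Complex.norm_exp] using h z hz
  simpa [Complex.norm_exp] using h1

/-- The weight identity behind the Schwarz-Pick inequality for planar harmonic maps. -/
theorem harmonic_weight_bound {x y t c s : ℝ} (hcs : c ^ 2 + s ^ 2 = 1)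
    (hxy : x ^ 2 + y ^ 2 ≤ 1) :
    x * (2 * t + (1 + t ^ 2) * c) + y * ((1 - t ^ 2) * s) ≤ (1 + t ^ 2) + 2 * t * c := by
  have hc : -1 ≤ c ∧ c ≤ 1 := abs_le.1 (abs_le_of_sq_le_sq (by nlinarith [sq_nonneg s]) one_pos.le)
  have hpos : 0 ≤ (1 + t ^ 2) + 2 * t * c := by nlinarith [sq_nonneg (t + c), sq_nonneg s]
  refine le_of_sq_le_sq ?_ hpos
  -- With `ζ = c + i s`, the weights form `|1 + tζ|²` times the unimodular number `(ζ + t) / (1 +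
  -- tζ)`; the claim is then Cauchy-Schwarz.
  have hW : (2 * t + (1 + t ^ 2) * c) ^ 2 + ((1 - t ^ 2) * s) ^ 2
      = ((1 + t ^ 2) + 2 * t * c) ^ 2 := by
    linear_combination (1 - t ^ 2) ^ 2 * hcs
  set A := 2 * t + (1 + t ^ 2) * c
  set B := (1 - t ^ 2) * s
  have h1 : (x * A + y * B) ^ 2 ≤ (x ^ 2 + y ^ 2) * (A ^ 2 + B ^ 2) := by
    nlinarith [sq_nonneg (x * B - y * A)]
  calc _ ≤ _ := h1
    _ ≤ 1 * (A ^ 2 + B ^ 2) := by gcongr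
    _ = _ := by rw [one_mul, hW]

/-- Schwarz-Pick inequality at the centre for a harmonic map into the unit disk, given by the real
parts of two holomorphic functions. -/
theorem schwarzPick_harmonic_center {T S : ℂ → ℂ} (hT : DifferentiableOn ℂ T (ball 0 1))
    (hS : DifferentiableOn ℂ S (ball 0 1))
    (hTS : ∀ z ∈ ball (0 : ℂ) 1, (T z).re ^ 2 + (S z).re ^ 2 ≤ 1) {ω : ℂ} (hω : ‖ω‖ = 1) :
    (ω * ((1 + (T 0).re ^ 2 : ℝ) * deriv T 0
      + Complex.I * (1 - (T 0).re ^ 2 : ℝ) * deriv S 0)).re ≤ 2 * (1 - (T 0).re ^ 2) := by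
  have h0 : (0 : ℂ) ∈ ball (0 : ℂ) 1 := mem_ball_self one_pos
  set t := (T 0).re with ht
  set X := (ω * ((1 + t ^ 2 : ℝ) * deriv T 0
      + Complex.I * (1 - t ^ 2 : ℝ) * deriv S 0)).re with hX
  have key : ∀ r ∈ Ioo (0 : ℝ) 1, r * X ≤ 2 * (1 - t ^ 2) := by
    rintro r ⟨hr0, hr1⟩
    have hsub : closedBall (0 : ℂ) r ⊆ ball 0 1 := closedBall_subset_ball hr1
    have hnhds : ball (0 : ℂ) 1 ∈ nhds (0 : ℂ) := isOpen_ball.mem_nhds h0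
    let cω : ℂ := (starRingEnd ℂ) ω
    let q : ℂ := (starRingEnd ℂ) (((1 + t ^ 2 : ℝ) : ℂ) * ω * T 0
      + Complex.I * ((1 - t ^ 2 : ℝ) : ℂ) * ω * S 0)
    -- On `|z| = r`, with `ζ = z / r`, the real part of `L` is the slack in `harmonic_weight_bound`
    -- for the angle of `ζ` measured from `ω`. The factor `conj ζ = r / z` would create a pole at 0;
    -- `dslope` removes it by subtracting the value at 0, and the `q` term restores what was
    -- subtracted, since `conj (q ζ)` and `q ζ` have the same real part.
    let L : ℂ → ℂ := fun z => ((1 + t ^ 2 : ℝ) : ℂ) + (2 * t * cω - q / 2) * (z / r)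
      - ((2 * t : ℝ) * T z
        + (1 + t ^ 2 : ℝ) / 2 * (ω * r * dslope T 0 z + cω * (T z * (z / r)))
        + Complex.I * (1 - t ^ 2 : ℝ) / 2 * (ω * r * dslope S 0 z - cω * (S z * (z / r))))
    have hdT : DifferentiableOn ℂ (dslope T 0) (ball 0 1) :=
      (Complex.differentiableOn_dslope hnhds).2 hT
    have hdS : DifferentiableOn ℂ (dslope S 0) (ball 0 1) :=
      (Complex.differentiableOn_dslope hnhds).2 hS
    have hLd : DifferentiableOn ℂ L (ball 0 1) := by
      simp only [L]
      fun_prop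
    have hLc : DiffContOnCl ℂ L (ball 0 r) :=
      (hLd.mono (by rwa [closure_ball _ hr0.ne'])).diffContOnCl
    have hpos := re_nonneg_of_forall_sphere hr0 hLc (fun z hz => by
      have hzn : ‖z‖ = r := by simpa using hz
      have hz0 : z ≠ 0 := by rintro rfl; simp at hzn; exact hr0.ne hzn
      have hr' : (r : ℂ) ≠ 0 := by exact_mod_cast hr0.ne'
      obtain ⟨ζ, hζ⟩ : ∃ ζ : ℂ, ζ = z / r := ⟨_, rfl⟩
      have hzζ : z = r * ζ := by rw [hζ]; field_simp
      have hζn : ‖ζ‖ = 1 := by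
        rw [hζ, norm_div, hzn, Complex.norm_real, Real.norm_of_nonneg hr0.le, div_self hr0.ne']
      have hζinv : ζ⁻¹ = (starRingEnd ℂ) ζ := Complex.inv_eq_conj hζn
      have hdsT : (r : ℂ) * dslope T 0 z = (starRingEnd ℂ) ζ * (T z - T 0) := by
        rw [dslope_of_ne _ hz0, slope_def_field, ← hζinv, hζ]; field_simp; simp
      have hdsS : (r : ℂ) * dslope S 0 z = (starRingEnd ℂ) ζ * (S z - S 0) := by
        rw [dslope_of_ne _ hz0, slope_def_field, ← hζinv, hζ]; field_simp; simp
      have hcs : (cω * ζ).re ^ 2 + (cω * ζ).im ^ 2 = 1 := by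
        have : ‖cω * ζ‖ ^ 2 = 1 := by rw [norm_mul, hζn]; simp [cω, hω]
        rw [← this, Complex.sq_norm, Complex.normSq_apply]; ring
      have hb := harmonic_weight_bound (t := t) hcs
        (hTS z (hsub (sphere_subset_closedBall hz)))
      have : (L z).re = (1 + t ^ 2) + 2 * t * (cω * ζ).re
          - ((T z).re * (2 * t + (1 + t ^ 2) * (cω * ζ).re)
            + (S z).re * ((1 - t ^ 2) * (cω * ζ).im)) := by
        simp only [L]
        rw [← hζ, mul_assoc ω, mul_assoc ω, hdsT, hdsS]
        simp [q, cω]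
        simp [← Complex.ofReal_pow]
        ring
      rw [this]
      linarith)
    have hL0 : (L 0).re = 1 - t ^ 2 - r / 2 * X := by
      simp only [L, dslope_same, hX]
      simp
      simp [← Complex.ofReal_pow, ← ht]
      ring
    rw [hL0] at hpos
    linarith
  have hlim : Filter.Tendsto (fun r : ℝ => r * X) (nhdsWithin 1 (Iio 1)) (nhds (1 * X)) :=
    (Continuous.tendsto (by fun_prop) 1).mono_left nhdsWithin_le_nhds
  have hmem : ∀ᶠ r in nhdsWithin (1 : ℝ) (Iio 1), r * X ≤ 2 * (1 - t ^ 2) :=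
    Filter.mem_of_superset (Ioo_mem_nhdsLT one_pos) key
  simpa using le_of_tendsto hlim hmem

/-- Schwarz-Pick inequality for a harmonic map into the unit disk, given by the real parts of two
holomorphic functions. -/
theorem schwarzPick_harmonic {T S : ℂ → ℂ} (hT : DifferentiableOn ℂ T (ball 0 1))
    (hS : DifferentiableOn ℂ S (ball 0 1))
    (hTS : ∀ z ∈ ball (0 : ℂ) 1, (T z).re ^ 2 + (S z).re ^ 2 ≤ 1) {ω : ℂ} (hω : ‖ω‖ = 1)
    {a : ℂ} (ha : a ∈ ball (0 : ℂ) 1) :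
    (1 - ‖a‖ ^ 2) * (ω * ((1 + (T a).re ^ 2 : ℝ) * deriv T a
      + Complex.I * (1 - (T a).re ^ 2 : ℝ) * deriv S a)).re ≤ 2 * (1 - (T a).re ^ 2) := by
  have ha1 : ‖a‖ < 1 := by simpa using ha
  let ca : ℂ := (starRingEnd ℂ) a
  let φ : ℂ → ℂ := fun z => (z + a) / (1 + ca * z)
  have hden : ∀ z ∈ ball (0 : ℂ) 1, 1 + ca * z ≠ 0 := by
    intro z hz h
    have hz1 : ‖z‖ < 1 := by simpa using hz
    have h1 : ‖ca * z‖ = 1 := by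
      rw [show ca * z = -1 by linear_combination h]; simp
    rw [norm_mul, show ‖ca‖ = ‖a‖ from Complex.norm_conj a] at h1
    nlinarith [norm_nonneg a, norm_nonneg z]
  have hφd : ∀ z ∈ ball (0 : ℂ) 1, HasDerivAt φ ((1 - ca * a) / (1 + ca * z) ^ 2) z := by
    intro z hz
    have h1 := ((hasDerivAt_id z).add_const a).div
      (((hasDerivAt_id z).const_mul ca).const_add 1) (hden z hz)
    have e : (1 : ℂ) * (1 + ca * z) - (z + a) * (ca * 1) = 1 - ca * a := by ring
    rw [← e]
    exact h1
  have hmaps : MapsTo φ (ball 0 1) (ball 0 1) := by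
    intro z hz
    have hz1 : ‖z‖ < 1 := by simpa using hz
    have hp : 0 < ‖1 + ca * z‖ := norm_pos_iff.2 (hden z hz)
    rw [mem_ball_zero_iff]
    simp only [φ]
    rw [norm_div, div_lt_one hp]
    refine lt_of_pow_lt_pow_left₀ 2 hp.le ?_
    have e : ‖1 + ca * z‖ ^ 2 - ‖z + a‖ ^ 2 = (1 - ‖z‖ ^ 2) * (1 - ‖a‖ ^ 2) := by
      simp [Complex.sq_norm, Complex.normSq_apply, ca]; ring
    have : 0 < (1 - ‖z‖ ^ 2) * (1 - ‖a‖ ^ 2) :=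
      mul_pos (by nlinarith [norm_nonneg z]) (by nlinarith [norm_nonneg a])
    linarith
  have hφ : DifferentiableOn ℂ φ (ball 0 1) := fun z hz =>
    (hφd z hz).differentiableAt.differentiableWithinAt
  have h0 : (0 : ℂ) ∈ ball (0 : ℂ) 1 := mem_ball_self one_pos
  have hφ0 : φ 0 = a := by simp [φ]
  have hca : 1 - ca * a = ((1 - ‖a‖ ^ 2 : ℝ) : ℂ) := by
    have : ca * a = ((‖a‖ ^ 2 : ℝ) : ℂ) := by
      rw [mul_comm]; simp only [ca]; rw [Complex.mul_conj, Complex.sq_norm]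
    rw [this]; push_cast; ring
  have hder : ∀ {G : ℂ → ℂ}, DifferentiableOn ℂ G (ball 0 1) →
      deriv (G ∘ φ) 0 = deriv G a * ((1 - ‖a‖ ^ 2 : ℝ) : ℂ) := by
    intro G hG
    have h1 : HasDerivAt G (deriv G a) (φ 0) := by
      rw [hφ0]; exact (hG.differentiableAt (isOpen_ball.mem_nhds ha)).hasDerivAt
    have h2 := (h1.comp (0 : ℂ) (hφd 0 h0)).deriv
    rw [h2, hca]; simp
  have := schwarzPick_harmonic_center (hT.comp hφ hmaps) (hS.comp hφ hmaps)
    (fun z hz => hTS _ (hmaps hz)) hω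
  rw [hder hT, hder hS] at this
  simp only [Function.comp, hφ0] at this
  refine le_trans (le_of_eq ?_) this
  rw [← Complex.re_ofReal_mul]
  congr 1
  ring

/-! ### Schwarz-Pick for conformal harmonic maps into the ball. -/

/-- A real harmonic function on the unit disk is the real part of a holomorphic function, whose
derivative determines the real differential. -/
theorem exists_holomorphic_re_eq {f : ℂ → ℝ}
    (hf : InnerProductSpace.HarmonicOnNhd f (ball (0 : ℂ) 1)) :
    ∃ T : ℂ → ℂ, DifferentiableOn ℂ T (ball 0 1) ∧ ∀ z ∈ ball (0 : ℂ) 1,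
      (T z).re = f z ∧ ∀ v : ℂ, fderiv ℝ f z v = (deriv T z * v).re := by
  obtain ⟨T, hT, hTf⟩ := hf.exists_analyticOnNhd_ball_re_eq
  refine ⟨T, hT.differentiableOn, fun z hz => ⟨hTf hz, fun v => ?_⟩⟩
  have h1 : HasFDerivAt T ((deriv T z) • (1 : ℂ →L[ℝ] ℂ)) z := by
    have := (hT z hz).differentiableAt.hasDerivAt.complexToReal_fderiv
    simpa using this
  have h2 : HasFDerivAt (fun z => (T z).re) (Complex.reCLM.comp ((deriv T z) • (1 : ℂ →L[ℝ] ℂ))) z :=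
    Complex.reCLM.hasFDerivAt.comp z h1
  have h3 : f =ᶠ[nhds z] fun z => (T z).re :=
    Filter.eventuallyEq_of_mem (isOpen_ball.mem_nhds hz) fun w hw => (hTf hw).symm
  rw [h3.fderiv_eq, h2.fderiv]
  simp

theorem harmonicOnNhd_inner {F : ℂ → E3} {s : Set ℂ} (hF : InnerProductSpace.HarmonicOnNhd F s)
    (u : E3) : InnerProductSpace.HarmonicOnNhd (fun z => inner ℝ u (F z)) s :=
  hF.comp_CLM (innerSL ℝ u)

theorem fderiv_inner_apply_eq {F : ℂ → E3} {z : ℂ} (hF : DifferentiableAt ℝ F z) (u : E3) (v : ℂ) :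
    fderiv ℝ (fun z => inner ℝ u (F z)) z v = inner ℝ u (fderiv ℝ F z v) := by
  have := ((innerSL ℝ u).hasFDerivAt.comp z hF.hasFDerivAt).fderiv
  exact (congrArg (fun l => l v) this).trans rfl

/-- The conformal factor: the differential of a conformal map scales inner products by `c > 0`. -/
theorem IsConformalMinimalImmersion.exists_inner_fderiv {F : ℂ → E3}
    (hmin : IsConformalMinimalImmersion F) {z : ℂ} (hz : z ∈ ball (0 : ℂ) 1) :
    ∃ c : ℝ, 0 < c ∧ ∀ v w : ℂ, inner ℝ (fderiv ℝ F z v) (fderiv ℝ F z w) = c * inner ℝ v w :=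
  conformalAt_iff'.1 (hmin.conformal z hz)

theorem IsConformalMinimalImmersion.differentiableAt {F : ℂ → E3}
    (hmin : IsConformalMinimalImmersion F) {z : ℂ} (hz : z ∈ ball (0 : ℂ) 1) :
    DifferentiableAt ℝ F z := (hmin.conformal z hz).differentiableAt

theorem norm_eq_sqrt_mul_of_inner {A : ℂ →L[ℝ] E3} {c : ℝ}
    (h : ∀ v w : ℂ, inner ℝ (A v) (A w) = c * inner ℝ v w) (v : ℂ) :
    ‖A v‖ = √c * ‖v‖ := by
  have h1 := h v v
  rw [real_inner_self_eq_norm_sq, real_inner_self_eq_norm_sq] at h1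
  rw [← Real.sqrt_sq (norm_nonneg (A v)), h1, Real.sqrt_mul' _ (sq_nonneg _),
    Real.sqrt_sq (norm_nonneg v)]

theorem inner_sq_add_inner_sq_le {u w x : E3} (hu : ‖u‖ = 1) (hw : ‖w‖ = 1)
    (huw : inner ℝ u w = (0 : ℝ)) : inner ℝ u x ^ 2 + inner ℝ w x ^ 2 ≤ ‖x‖ ^ 2 := by
  set a : ℝ := inner ℝ u x with ha
  set b : ℝ := inner ℝ w x with hb
  have h : ‖x - (a • u + b • w)‖ ^ 2 = ‖x‖ ^ 2 - a ^ 2 - b ^ 2 := by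
    rw [norm_sub_sq_real, norm_add_sq_real, inner_add_right, inner_smul_right, inner_smul_right,
      inner_smul_left, inner_smul_right, huw, norm_smul, norm_smul, hu, hw, real_inner_comm u x,
      real_inner_comm w x, ← ha, ← hb]
    simp
    ring
  nlinarith [sq_nonneg ‖x - (a • u + b • w)‖]

/-- Schwarz-Pick inequality for conformal harmonic maps of the disk into the unit ball. -/
theorem IsConformalMinimalImmersion.schwarzPick {F : ℂ → E3}
    (hmin : IsConformalMinimalImmersion F) (hF : ∀ z ∈ ball (0 : ℂ) 1, ‖F z‖ ≤ 1)
    {u : E3} (hu : ‖u‖ = 1) {z : ℂ} (hz : z ∈ ball (0 : ℂ) 1) (v : ℂ) :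
    (1 - ‖z‖ ^ 2) * inner ℝ u (fderiv ℝ F z v) ≤ ‖v‖ * (1 - inner ℝ u (F z) ^ 2) := by
  obtain ⟨c, hc, hconf⟩ := hmin.exists_inner_fderiv hz
  have hd := hmin.differentiableAt hz
  have hnorm := norm_eq_sqrt_mul_of_inner hconf
  have hz1 : 0 < 1 - ‖z‖ ^ 2 := by
    have : ‖z‖ < 1 := by simpa using hz
    nlinarith [norm_nonneg z]
  have ht1 : inner ℝ u (F z) ^ 2 ≤ (1 : ℝ) := by
    have := abs_real_inner_le_norm u (F z)
    rw [hu, one_mul] at this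
    have := this.trans (hF z hz)
    nlinarith [sq_abs (inner ℝ u (F z)), abs_nonneg (inner ℝ u (F z))]
  obtain ⟨T, hT, hTf⟩ := exists_holomorphic_re_eq (harmonicOnNhd_inner hmin.harmonic u)
  have hdT : ∀ v, inner ℝ u (fderiv ℝ F z v) = (deriv T z * v).re := fun v => by
    rw [← fderiv_inner_apply_eq hd, (hTf z hz).2]
  have hle : inner ℝ u (fderiv ℝ F z v) ≤ ‖deriv T z‖ * ‖v‖ := by
    rw [hdT, ← norm_mul]; exact Complex.re_le_norm _
  suffices hm : (1 - ‖z‖ ^ 2) * ‖deriv T z‖ ≤ 1 - inner ℝ u (F z) ^ 2 by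
    calc _ ≤ (1 - ‖z‖ ^ 2) * (‖deriv T z‖ * ‖v‖) := by gcongr
      _ = ‖v‖ * ((1 - ‖z‖ ^ 2) * ‖deriv T z‖) := by ring
      _ ≤ _ := by gcongr
  by_cases h0 : deriv T z = 0
  · rw [h0]; simpa using ht1
  have hpos : 0 < ‖deriv T z‖ := norm_pos_iff.2 h0
  -- The direction of steepest ascent of `⟪u, F⟫` at `z`.
  let ω : ℂ := (starRingEnd ℂ) (deriv T z) / ‖deriv T z‖
  have hω : ‖ω‖ = 1 := by
    simp only [ω]; rw [norm_div, Complex.norm_conj, Complex.norm_real, norm_norm, div_self hpos.ne']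
  have hTω : deriv T z * ω = ‖deriv T z‖ := by
    have : (‖deriv T z‖ : ℂ) ≠ 0 := by exact_mod_cast hpos.ne'
    simp only [ω]
    rw [← mul_div_assoc, Complex.mul_conj, ← Complex.sq_norm, div_eq_iff this]
    push_cast; ring
  let k := √c
  have hk : 0 < k := Real.sqrt_pos.2 hc
  -- The function `⟪u, F⟫` is stationary in the direction `iω`, so this unit tangent vector is
  -- orthogonal to `u`. The planar inequality is applied to the projection of `F` to the span of `u`
  -- and `w`.
  let w : E3 := k⁻¹ • fderiv ℝ F z (Complex.I * ω)
  have hw : ‖w‖ = 1 := by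
    simp only [w]
    rw [norm_smul, hnorm, norm_mul, hω, Complex.norm_I, Real.norm_of_nonneg (inv_nonneg.2 hk.le)]
    simp only [mul_one]
    exact inv_mul_cancel₀ hk.ne'
  have huw : inner ℝ u w = (0 : ℝ) := by
    simp only [w]
    rw [inner_smul_right, hdT, show deriv T z * (Complex.I * ω) = Complex.I * (deriv T z * ω) by ring,
      hTω]
    simp
  obtain ⟨S, hS, hSf⟩ := exists_holomorphic_re_eq (harmonicOnNhd_inner hmin.harmonic w)
  have hSω : (deriv S z * (Complex.I * ω)).re = k := by
    rw [← (hSf z hz).2, fderiv_inner_apply_eq hd]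
    simp only [w]
    rw [real_inner_smul_left, real_inner_self_eq_norm_sq, hnorm, norm_mul, hω, Complex.norm_I]
    change k⁻¹ * (k * (1 * 1)) ^ 2 = k
    field_simp
  have hTk : ‖deriv T z‖ ≤ k := by
    have h1 : ‖deriv T z‖ = inner ℝ u (fderiv ℝ F z ω) := by
      rw [hdT, hTω, Complex.ofReal_re]
    rw [h1]
    refine (real_inner_le_norm _ _).trans ?_
    rw [hu, hnorm, hω, one_mul, mul_one]
  have hmain := schwarzPick_harmonic hT hS (fun x hx => by
    rw [(hTf x hx).1, (hSf x hx).1]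
    refine (inner_sq_add_inner_sq_le hu hw huw).trans ?_
    nlinarith [hF x hx, norm_nonneg (F x)]) hω hz
  rw [(hTf z hz).1] at hmain
  set t : ℝ := inner ℝ u (F z) with ht
  have he : (ω * ((1 + t ^ 2 : ℝ) * deriv T z + Complex.I * (1 - t ^ 2 : ℝ) * deriv S z)).re
      = (1 + t ^ 2) * ‖deriv T z‖ + (1 - t ^ 2) * k := by
    rw [show ω * ((1 + t ^ 2 : ℝ) * deriv T z + Complex.I * (1 - t ^ 2 : ℝ) * deriv S z)
        = (1 + t ^ 2 : ℝ) * (deriv T z * ω) + (1 - t ^ 2 : ℝ) * (deriv S z * (Complex.I * ω)) by ring,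
      Complex.add_re, Complex.re_ofReal_mul, Complex.re_ofReal_mul, hSω, hTω, Complex.ofReal_re]
  rw [he] at hmain
  -- Replacing `k` by the smaller `‖deriv T z‖` turns the weights `1 + t²` and `1 - t²` into a total
  -- weight 2.
  have h2 : (1 - t ^ 2) * ‖deriv T z‖ ≤ (1 - t ^ 2) * k := by gcongr
  nlinarith [mul_le_mul_of_nonneg_left h2 hz1.le]

/-! ### Maximum principles and the image of the disk. -/

/-- Strong maximum principle for real harmonic functions on the unit disk. -/
theorem harmonic_eqOn_of_isMaxOn {f : ℂ → ℝ}
    (hf : InnerProductSpace.HarmonicOnNhd f (ball (0 : ℂ) 1)) {c : ℂ} (hc : c ∈ ball (0 : ℂ) 1)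
    (hmax : IsMaxOn f (ball 0 1) c) : ∀ z ∈ ball (0 : ℂ) 1, f z = f c := by
  obtain ⟨T, hT, hTf⟩ := exists_holomorphic_re_eq hf
  have hn : ∀ z ∈ ball (0 : ℂ) 1, ‖Complex.exp (T z)‖ = Real.exp (f z) := fun z hz => by
    rw [Complex.norm_exp, (hTf z hz).1]
  have hd : DifferentiableOn ℂ (fun z => Complex.exp (T z)) (ball 0 1) := hT.cexp
  have hm : IsMaxOn (norm ∘ fun z => Complex.exp (T z)) (ball 0 1) c := fun z hz => by
    change ‖Complex.exp (T z)‖ ≤ ‖Complex.exp (T c)‖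
    rw [hn z hz, hn c hc]
    exact Real.exp_le_exp.2 (hmax hz)
  intro z hz
  have h := Complex.norm_eqOn_of_isPreconnected_of_isMaxOn (convex_ball (0 : ℂ) 1).isPreconnected
    isOpen_ball hd hc hm hz
  change ‖Complex.exp (T z)‖ = ‖Complex.exp (T c)‖ at h
  rw [hn z hz, hn c hc] at h
  exact Real.exp_injective h

/-- Weak maximum principle for real harmonic functions on the unit disk. -/
theorem harmonic_le_of_sphere_le {f : ℂ → ℝ}
    (hf : InnerProductSpace.HarmonicOnNhd f (ball (0 : ℂ) 1))
    (hcont : ContinuousOn f (closedBall 0 1)) {M : ℝ} (hM : ∀ z ∈ sphere (0 : ℂ) 1, f z ≤ M) :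
    ∀ z ∈ closedBall (0 : ℂ) 1, f z ≤ M := by
  obtain ⟨c, hc, hmax⟩ := (isCompact_closedBall (0 : ℂ) 1).exists_isMaxOn
    ⟨0, mem_closedBall_self zero_le_one⟩ hcont
  suffices f c ≤ M from fun z hz => (hmax hz).trans this
  rcases (mem_closedBall.1 hc).eq_or_lt with h | h
  · exact hM c h
  have hcb : c ∈ ball (0 : ℂ) 1 := h
  have heq := harmonic_eqOn_of_isMaxOn hf hcb (hmax.on_subset ball_subset_closedBall)
  have hcl : EqOn f (fun _ => f c) (closure (ball (0 : ℂ) 1)) :=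
    EqOn.of_subset_closure (s := ball (0 : ℂ) 1) (t := closure (ball (0 : ℂ) 1)) heq
      (by rwa [closure_ball _ one_ne_zero]) continuousOn_const subset_closure Subset.rfl
  rw [closure_ball _ one_ne_zero] at hcl
  have h1 : (1 : ℂ) ∈ sphere (0 : ℂ) 1 := by simp
  exact (hcl (sphere_subset_closedBall h1)).symm.le.trans (hM 1 h1)

/-- The weak maximum principle is applied to the component of `F` in the direction of its own value
at `z`. -/
theorem IsConformalMinimalImmersion.norm_le_one {F : ℂ → E3}
    (hmin : IsConformalMinimalImmersion F) (hcont : ContinuousOn F (closedBall (0 : ℂ) 1))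
    (hbdry : ∀ z ∈ sphere (0 : ℂ) 1, F z ∈ sphere (0 : E3) 1) :
    ∀ z ∈ closedBall (0 : ℂ) 1, ‖F z‖ ≤ 1 := by
  intro z hz
  by_cases h0 : ‖F z‖ = 0
  · rw [h0]; exact zero_le_one
  let u : E3 := ‖F z‖⁻¹ • F z
  have hu : ‖u‖ = 1 := by
    simp only [u]; rw [norm_smul, norm_inv, norm_norm, inv_mul_cancel₀ h0]
  have h := harmonic_le_of_sphere_le (harmonicOnNhd_inner hmin.harmonic u)
    (continuousOn_const.inner hcont) (M := 1) (fun w hw => by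
      have h1 : ‖F w‖ = 1 := by simpa using hbdry w hw
      simpa [hu, h1] using real_inner_le_norm u (F w)) z hz
  have h2 : inner ℝ u (F z) = ‖F z‖ := by
    simp only [u]
    rw [real_inner_smul_left, real_inner_self_eq_norm_sq]
    field_simp
  linarith [h2 ▸ h]

/-- If `‖F z‖ = 1`, then `⟪F z, F⟫` has an interior maximum and is constantly 1. Within the unit
ball this forces `F` to be constant, against conformality. -/
theorem IsConformalMinimalImmersion.norm_lt_one {F : ℂ → E3}
    (hmin : IsConformalMinimalImmersion F) (hF : ∀ z ∈ ball (0 : ℂ) 1, ‖F z‖ ≤ 1)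
    {z : ℂ} (hz : z ∈ ball (0 : ℂ) 1) : ‖F z‖ < 1 := by
  refine lt_of_le_of_ne (hF z hz) fun h => ?_
  have hzz : inner ℝ (F z) (F z) = (1 : ℝ) := by rw [real_inner_self_eq_norm_sq, h, one_pow]
  have hle : ∀ w ∈ ball (0 : ℂ) 1, inner ℝ (F z) (F w) ≤ (1 : ℝ) := fun w hw => by
    have := real_inner_le_norm (F z) (F w)
    rw [h, one_mul] at this
    exact this.trans (hF w hw)
  have hconst := harmonic_eqOn_of_isMaxOn (harmonicOnNhd_inner hmin.harmonic (F z)) hz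
    (fun w hw => (hle w hw).trans hzz.symm.le)
  have hFeq : F =ᶠ[nhds z] fun _ => F z := by
    refine Filter.eventuallyEq_of_mem (isOpen_ball.mem_nhds hz) fun w hw => ?_
    have h1 : ‖F w - F z‖ ^ 2 ≤ 0 := by
      have h2 := hconst w hw
      rw [hzz, real_inner_comm] at h2
      rw [norm_sub_sq_real, h2, h]
      nlinarith [hF w hw, norm_nonneg (F w)]
    have h3 : ‖F w - F z‖ = 0 := by nlinarith [norm_nonneg (F w - F z)]
    exact sub_eq_zero.1 (norm_eq_zero.1 h3)
  obtain ⟨c, hc, hconf⟩ := hmin.exists_inner_fderiv hz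
  have h4 := hconf 1 1
  rw [hFeq.fderiv_eq] at h4
  simp at h4
  exact hc.ne h4

/-! ### The boundary Schwarz lemma. -/

/-- Integrated Schwarz-Pick inequality along a radius. -/
theorem schwarzPick_radial {t t' : ℝ → ℝ}
    (ht : ∀ r ∈ Ico (0 : ℝ) 1, HasDerivAt t (t' r) r) (hlt : ∀ r ∈ Ico (0 : ℝ) 1, t r < 1)
    (hd : ∀ r ∈ Ico (0 : ℝ) 1, (1 - r ^ 2) * t' r ≤ 1 - t r ^ 2) {r : ℝ} (hr : r ∈ Ico (0 : ℝ) 1) :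
    (1 + t r) * (1 - r) / ((1 - t r) * (1 + r)) ≤ (1 + t 0) / (1 - t 0) := by
  -- For `|t r| < 1` this is `exp (2 (artanh (t r) - artanh r))`. The rational form needs only `t r
  -- < 1`.
  let Q : ℝ → ℝ := fun r => (1 + t r) * (1 - r) / ((1 - t r) * (1 + r))
  have hQ : ∀ r ∈ Ico (0 : ℝ) 1, HasDerivAt Q
      (2 * ((1 - r ^ 2) * t' r - (1 - t r ^ 2)) / ((1 - t r) * (1 + r)) ^ 2) r := by
    intro r hr
    have hne : (1 - t r) * (1 + r) ≠ 0 :=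
      (mul_pos (by linarith [hlt r hr]) (by linarith [hr.1])).ne'
    have h := (((ht r hr).const_add 1).mul ((hasDerivAt_id r).const_sub 1)).div
      (((ht r hr).const_sub 1).mul ((hasDerivAt_id r).const_add 1)) hne
    refine HasDerivAt.congr_deriv h ?_
    simp only [id, Pi.mul_apply]
    congr 1
    ring
  have hanti : AntitoneOn Q (Ico 0 1) := by
    refine antitoneOn_of_deriv_nonpos (convex_Ico 0 1)
      (fun x hx => (hQ x hx).continuousAt.continuousWithinAt)
      (fun x hx => (hQ x (interior_subset hx)).differentiableAt.differentiableWithinAt)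
      (fun x hx => ?_)
    have hx' := interior_subset hx
    rw [(hQ x hx').deriv]
    exact div_nonpos_of_nonpos_of_nonneg (by linarith [hd x hx']) (sq_nonneg _)
  have := hanti (left_mem_Ico.2 one_pos) hr hr.1
  simpa [Q] using this

/-- Boundary Schwarz lemma: lower bound of the radial derivative on the unit circle. -/
theorem IsConformalMinimalImmersion.boundary_schwarz {F : ℂ → E3}
    (hmin : IsConformalMinimalImmersion F) (hC1 : ContDiffOn ℝ 1 F (closedBall (0 : ℂ) 1))
    (hbdry : ∀ z ∈ sphere (0 : ℂ) 1, F z ∈ sphere (0 : E3) 1) {ζ : ℂ}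
    (hζ : ζ ∈ sphere (0 : ℂ) 1) :
    (1 - ‖F 0‖) / (1 + ‖F 0‖) ≤ ‖fderivWithin ℝ F (closedBall 0 1) ζ ζ‖ := by
  have hle := hmin.norm_le_one hC1.continuousOn hbdry
  have hle' : ∀ z ∈ ball (0 : ℂ) 1, ‖F z‖ ≤ 1 := fun z hz => hle z (ball_subset_closedBall hz)
  have hlt : ∀ z ∈ ball (0 : ℂ) 1, ‖F z‖ < 1 := fun z hz => hmin.norm_lt_one hle' hz
  have hζn : ‖ζ‖ = 1 := by simpa using hζ
  have hq : ‖F ζ‖ = 1 := by simpa using hbdry ζ hζ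
  set a := ‖F 0‖ with ha
  have ha1 : a < 1 := hlt 0 (mem_ball_self one_pos)
  have ha0 : 0 ≤ a := norm_nonneg _
  have hmem : ∀ r ∈ Ico (0 : ℝ) 1, (r : ℂ) * ζ ∈ ball (0 : ℂ) 1 := fun r hr => by
    simpa [hζn, abs_of_nonneg hr.1] using hr.2
  let t : ℝ → ℝ := fun r => inner ℝ (F ζ) (F (r * ζ))
  have hline : ∀ r : ℝ, HasDerivAt (fun r : ℝ => (r : ℂ) * ζ) ζ r := fun r => by
    simpa using (Complex.ofRealCLM.hasDerivAt (x := r)).mul_const ζ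
  have ht : ∀ r ∈ Ico (0 : ℝ) 1,
      HasDerivAt t (inner ℝ (F ζ) (fderiv ℝ F (r * ζ) ζ)) r := fun r hr =>
    (innerSL ℝ (F ζ)).hasFDerivAt.comp_hasDerivAt r
      ((hmin.differentiableAt (hmem r hr)).hasFDerivAt.comp_hasDerivAt r (hline r))
  have habs : ∀ r ∈ Ico (0 : ℝ) 1, |t r| ≤ ‖F (r * ζ)‖ := fun r hr => by
    simpa [hq] using abs_real_inner_le_norm (F ζ) (F (r * ζ))
  have htlt : ∀ r ∈ Ico (0 : ℝ) 1, t r < 1 := fun r hr =>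
    ((le_abs_self _).trans (habs r hr)).trans_lt (hlt _ (hmem r hr))
  -- The radial inequality rearranged as a bound for the difference quotient of `t` at 1; as `r → 1`
  -- the first factor tends to 1.
  have hrad : ∀ r ∈ Ico (0 : ℝ) 1,
      (1 + t r) / (1 + r) * ((1 - a) / (1 + a)) ≤ (t r - 1) / (r - 1) := by
    intro r hr
    have h := schwarzPick_radial ht htlt (fun r hr => by
      have := hmin.schwarzPick hle' hq (hmem r hr) ζ
      simpa [hζn] using this) hr
    have h0 : (0 : ℝ) ∈ Ico (0 : ℝ) 1 := left_mem_Ico.2 one_pos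
    have ht0 : t 0 ≤ a := by
      have := (le_abs_self _).trans (habs 0 h0)
      simpa using this
    have h1 : (1 + t 0) / (1 - t 0) ≤ (1 + a) / (1 - a) := by
      rw [div_le_div_iff₀ (by linarith) (by linarith)]
      nlinarith
    have h2 := h.trans h1
    have p1 : 0 < 1 - t r := by linarith [htlt r hr]
    have p2 : 0 < 1 - r := by linarith [hr.2]
    have p3 : 0 < 1 + r := by linarith [hr.1]
    rw [div_le_div_iff₀ (mul_pos p1 p3) (by linarith)] at h2
    rw [show (t r - 1) / (r - 1) = (1 - t r) / (1 - r) by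
      rw [← neg_sub 1 (t r), ← neg_sub 1 r, neg_div_neg_eq], div_mul_div_comm,
      div_le_div_iff₀ (mul_pos p3 (by linarith)) p2]
    linarith
  let D : ℝ := inner ℝ (F ζ) (fderivWithin ℝ F (closedBall 0 1) ζ ζ)
  have ht1 : t 1 = 1 := by
    simp only [t]; rw [Complex.ofReal_one, one_mul, real_inner_self_eq_norm_sq, hq, one_pow]
  have hder : HasDerivWithinAt t D (Icc 0 1) 1 := by
    have hF : HasFDerivWithinAt F (fderivWithin ℝ F (closedBall 0 1) ζ) (closedBall 0 1)
        (((1 : ℝ) : ℂ) * ζ) := by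
      rw [Complex.ofReal_one, one_mul]
      exact (hC1.differentiableOn one_ne_zero ζ (sphere_subset_closedBall hζ)).hasFDerivWithinAt
    have hmaps : MapsTo (fun r : ℝ => (r : ℂ) * ζ) (Icc 0 1) (closedBall 0 1) := fun r hr => by
      simpa [hζn, abs_of_nonneg hr.1] using hr.2
    exact (innerSL ℝ (F ζ)).hasFDerivAt.comp_hasDerivWithinAt (1 : ℝ)
      (hF.comp_hasDerivWithinAt (1 : ℝ) (hline 1).hasDerivWithinAt hmaps)
  have hcont : Filter.Tendsto t (nhdsWithin 1 (Ico 0 1)) (nhds 1) := by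
    have := (hder.mono Ico_subset_Icc_self).continuousWithinAt.tendsto
    rwa [ht1] at this
  have hslope : Filter.Tendsto (fun r => (t r - 1) / (r - 1)) (nhdsWithin 1 (Ico 0 1)) (nhds D) := by
    have := hasDerivWithinAt_iff_tendsto_slope.1 hder
    rw [Icc_sdiff_right] at this
    refine this.congr fun r => ?_
    rw [slope_def_field, ht1]
  have hlim : Filter.Tendsto (fun r : ℝ => (1 + t r) / (1 + r) * ((1 - a) / (1 + a)))
      (nhdsWithin 1 (Ico 0 1)) (nhds ((1 + 1) / (1 + 1) * ((1 - a) / (1 + a)))) := by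
    refine ((hcont.const_add 1).div ?_ (by norm_num)).mul_const _
    exact ((continuous_const.add continuous_id).tendsto (1 : ℝ)).mono_left nhdsWithin_le_nhds
  have hne : (nhdsWithin (1 : ℝ) (Ico 0 1)).NeBot := by
    rw [nhdsWithin_Ico_eq_nhdsLT one_pos]; infer_instance
  have hD : (1 - a) / (1 + a) ≤ D := by
    have := le_of_tendsto_of_tendsto hlim hslope
      (Filter.eventually_of_mem self_mem_nhdsWithin hrad)
    simpa using this
  refine hD.trans ?_
  simpa [hq] using real_inner_le_norm (F ζ) (fderivWithin ℝ F (closedBall 0 1) ζ ζ)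

/-! ### The half-sphere condition and the comparison function. -/

theorem inner_eq_sum_three (x y : E3) : inner ℝ x y = x 0 * y 0 + x 1 * y 1 + x 2 * y 2 := by
  simp [PiLp.inner_apply, Fin.sum_univ_three, mul_comm]

/-- Used with `p = F_x`, `q = F_y`: the sum of squares is `|g|²`, so `|g|` is expressed through `⟪e,
p × q⟫`. The squares are evaluated by the Gram determinant (`hgram`), the mixed term by Lagrange's
identity with `u × (e × u) = e` (`hcross`). -/
theorem cross_inner_identities {p q e u : E3} {c : ℝ} (hp : inner ℝ p p = c) (hq : inner ℝ q q = c)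
    (hpq : inner ℝ p q = (0 : ℝ)) (he : inner ℝ e e = (1 : ℝ)) (hu : inner ℝ u u = (1 : ℝ))
    (heu : inner ℝ e u = (0 : ℝ)) :
    c * ((inner ℝ u p + inner ℝ (cross3 e u) q) ^ 2 + (inner ℝ (cross3 e u) p - inner ℝ u q) ^ 2)
      = (c + inner ℝ e (cross3 p q)) ^ 2 ∧ inner ℝ e (cross3 p q) ^ 2 ≤ c ^ 2 := by
  have hgram : ∀ x y z : E3, inner ℝ x (cross3 y z) ^ 2
      = inner ℝ x x * inner ℝ y y * inner ℝ z z + 2 * inner ℝ x y * inner ℝ y z * inner ℝ x z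
        - inner ℝ x x * inner ℝ y z ^ 2 - inner ℝ y y * inner ℝ x z ^ 2
        - inner ℝ z z * inner ℝ x y ^ 2 := by
    intro x y z
    simp only [inner_eq_sum_three, cross3, cross_apply, Matrix.cons_val]
    ring
  have hcross : inner ℝ u p * inner ℝ (cross3 e u) q - inner ℝ u q * inner ℝ (cross3 e u) p
      = inner ℝ e (cross3 p q) * inner ℝ u u - inner ℝ e u * inner ℝ u (cross3 p q) := by
    simp only [inner_eq_sum_three, cross3, cross_apply, Matrix.cons_val]
    ring
  have g1 := hgram e p q
  have g2 := hgram p e u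
  have g3 := hgram q e u
  rw [hu, heu] at hcross
  rw [he, hp, hq, hpq, real_inner_comm p e, real_inner_comm q e] at g1
  rw [he, hp, hu, heu] at g2
  rw [he, hq, hu, heu] at g3
  rw [real_inner_comm p u, real_inner_comm q u, real_inner_comm p (cross3 e u),
    real_inner_comm q (cross3 e u)] at *
  constructor
  · linear_combination c * g2 + c * g3 + 2 * c * hcross - g1
  · have hc : 0 ≤ c := by rw [← hp]; exact real_inner_self_nonneg
    nlinarith [mul_nonneg hc (sq_nonneg (inner ℝ p e)), mul_nonneg hc (sq_nonneg (inner ℝ q e))]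

theorem exists_unit_orthogonal (e : E3) : ∃ u : E3, inner ℝ u u = (1 : ℝ) ∧ inner ℝ e u = (0 : ℝ) := by
  have h : (ℝ ∙ e)ᗮ ≠ ⊥ := by
    intro h
    have h1 := (ℝ ∙ e).finrank_add_finrank_orthogonal
    have h2 : Module.finrank ℝ (ℝ ∙ e) ≤ 1 := by
      simpa using finrank_span_le_card (R := ℝ) ({e} : Set E3)
    rw [h, finrank_bot, finrank_euclideanSpace_fin] at h1
    omega
  obtain ⟨x, hx, hx0⟩ := Submodule.exists_mem_ne_zero_of_ne_bot h
  have hx' := Submodule.mem_orthogonal_singleton_iff_inner_right.1 hx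
  have hn : ‖x‖ ≠ 0 := norm_ne_zero_iff.2 hx0
  refine ⟨‖x‖⁻¹ • x, ?_, by rw [inner_smul_right, hx', mul_zero]⟩
  rw [real_inner_self_eq_norm_sq, norm_smul, norm_inv, norm_norm, inv_mul_cancel₀ hn, one_pow]

/-- A lower bound for the differential on the unit circle gives half of it in the disk, when the
unit normals lie in a half-sphere. The proof compares the conformal factor with `|g|`, where `g` is
the holomorphic function `⟪F_x - i F_y, u + i e × u⟫`, of modulus `|F_x| (1 + ⟪e, n⟫)`. -/
theorem IsConformalMinimalImmersion.le_conformalFactor {F : ℂ → E3}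
    (hmin : IsConformalMinimalImmersion F) (hC1 : ContDiffOn ℝ 1 F (closedBall (0 : ℂ) 1))
    (hnormal : NormalsInHalfSphere F) {m : ℝ} (hm : 0 < m)
    (hb : ∀ ζ ∈ sphere (0 : ℂ) 1, m ≤ ‖fderivWithin ℝ F (closedBall 0 1) ζ ζ‖)
    {z : ℂ} (hz : z ∈ ball (0 : ℂ) 1) (v : ℂ) :
    1 / 2 * m * ‖v‖ ≤ ‖fderiv ℝ F z v‖ := by
  obtain ⟨e, he, hen⟩ := hnormal
  obtain ⟨u, hu, heu⟩ := exists_unit_orthogonal e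
  let w := cross3 e u
  let A : ℂ → ℂ →L[ℝ] E3 := fderivWithin ℝ F (closedBall 0 1)
  have hud : UniqueDiffOn ℝ (closedBall (0 : ℂ) 1) :=
    uniqueDiffOn_convex (convex_closedBall 0 1)
      ⟨0, by rw [interior_closedBall _ one_ne_zero]; exact mem_ball_self one_pos⟩
  have hAc : ContinuousOn A (closedBall 0 1) := hC1.continuousOn_fderivWithin hud le_rfl
  have hAv : ∀ v, ContinuousOn (fun z => A z v) (closedBall 0 1) := fun v =>
    hAc.clm_apply continuousOn_const
  have hA : ∀ z ∈ ball (0 : ℂ) 1, A z = fderiv ℝ F z := fun z hz =>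
    fderivWithin_of_mem_nhds (Filter.mem_of_superset (isOpen_ball.mem_nhds hz) ball_subset_closedBall)
  let g : ℂ → ℂ := fun z => ((inner ℝ u (A z 1) + inner ℝ w (A z Complex.I) : ℝ) : ℂ)
    + Complex.I * ((inner ℝ w (A z 1) - inner ℝ u (A z Complex.I) : ℝ) : ℂ)
  have hgc : ContinuousOn g (closedBall 0 1) := by
    have h1 := hAv 1
    have h2 := hAv Complex.I
    simp only [g]
    fun_prop
  have hgd : DifferentiableOn ℂ g (ball 0 1) := by
    have h : ∀ x : E3, DifferentiableOn ℂ (fun z =>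
        (fderiv ℝ (fun z => inner ℝ x (F z)) z 1 : ℂ)
          - Complex.I * (fderiv ℝ (fun z => inner ℝ x (F z)) z Complex.I : ℂ)) (ball 0 1) :=
      fun x z hz => (HarmonicAt.differentiableAt_complex_partial
        (harmonicOnNhd_inner hmin.harmonic x z hz)).differentiableWithinAt
    refine ((h u).add ((h w).const_mul Complex.I)).congr fun z hz => ?_
    have hd := hmin.differentiableAt hz
    simp only [g, hA z hz, Pi.add_apply, fderiv_inner_apply_eq hd]
    push_cast
    linear_combination (inner ℝ w (fderiv ℝ F z Complex.I) : ℂ) * Complex.I_mul_I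
  have hgn : ∀ z, ‖g z‖ ^ 2 = (inner ℝ u (A z 1) + inner ℝ w (A z Complex.I)) ^ 2
      + (inner ℝ w (A z 1) - inner ℝ u (A z Complex.I)) ^ 2 := fun z => by
    rw [Complex.sq_norm, Complex.normSq_apply]
    simp [g]
    ring
  -- Here `c |g|² = (c + d)²` with `d = ⟪e, F_x × F_y⟫`. The half-sphere condition `d ≥ 0` gives `√c
  -- ≤ |g|`; the bound `d ≤ c` gives `|g| ≤ 2√c`, the source of the constant `1/2`.
  have hcmp : ∀ z ∈ ball (0 : ℂ) 1, ∀ v, ‖A z v‖ ≤ ‖g z‖ * ‖v‖ ∧ ‖g z‖ * ‖v‖ ≤ 2 * ‖A z v‖ := by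
    intro z hz v
    obtain ⟨c, hc, hconf⟩ := hmin.exists_inner_fderiv hz
    rw [← hA z hz] at hconf
    have hp : inner ℝ (A z 1) (A z 1) = c := by rw [hconf]; simp
    have hq : inner ℝ (A z Complex.I) (A z Complex.I) = c := by rw [hconf]; simp
    have hpq : inner ℝ (A z 1) (A z Complex.I) = (0 : ℝ) := by rw [hconf]; simp
    obtain ⟨h1, h2⟩ := cross_inner_identities hp hq hpq
      (by rw [real_inner_self_eq_norm_sq, he, one_pow]) hu heu
    have hd : 0 ≤ inner ℝ e (cross3 (A z 1) (A z Complex.I)) := by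
      have := hen z hz
      simp only [unitNormal] at this
      rw [← hA z hz, inner_smul_right] at this
      by_cases hN : cross3 (A z 1) (A z Complex.I) = 0
      · rw [hN, inner_zero_right]
      · exact nonneg_of_mul_nonneg_right this (inv_pos.2 (norm_pos_iff.2 hN))
    set d : ℝ := inner ℝ e (cross3 (A z 1) (A z Complex.I))
    have hdc : d ≤ c := le_of_sq_le_sq h2 hc.le
    rw [← hgn z] at h1
    have hs : √c ^ 2 = c := Real.sq_sqrt hc.le
    have hlow : √c ≤ ‖g z‖ := by
      refine le_of_sq_le_sq ?_ (norm_nonneg _)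
      rw [hs]
      refine le_of_mul_le_mul_left (a := c) ?_ hc
      rw [h1]; nlinarith
    have hup : ‖g z‖ ≤ 2 * √c := by
      refine le_of_sq_le_sq ?_ (by positivity)
      rw [mul_pow, hs]
      refine le_of_mul_le_mul_left (a := c) ?_ hc
      rw [h1]; nlinarith
    rw [norm_eq_sqrt_mul_of_inner hconf]
    exact ⟨by gcongr, by rw [← mul_assoc]; gcongr⟩
  have hbd : ∀ ζ ∈ sphere (0 : ℂ) 1, m ≤ ‖g ζ‖ := by
    intro ζ hζ
    have hζn : ‖ζ‖ = 1 := by simpa using hζ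
    have hmem : ζ ∈ closure (ball (0 : ℂ) 1) := by
      rw [closure_ball _ one_ne_zero]; exact sphere_subset_closedBall hζ
    have hcl : closure (ball (0 : ℂ) 1) ⊆ closedBall 0 1 := closure_ball_subset_closedBall
    -- Conformality and the normal condition are given only in the open disk, so the comparison
    -- reaches the circle by continuity of `dF`.
    have := le_on_closure (s := ball (0 : ℂ) 1) (f := fun z => ‖A z ζ‖) (g := fun z => ‖g z‖ * ‖ζ‖)
      (fun z hz => (hcmp z hz ζ).1) ((hAv ζ).norm.mono hcl) ((hgc.norm.mul continuousOn_const).mono hcl)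
      hmem
    simp only [hζn, mul_one] at this
    exact (hb ζ hζ).trans this
  have hg0 : ∀ z ∈ closure (ball (0 : ℂ) 1), g z ≠ 0 := by
    intro z hz
    rw [closure_ball _ one_ne_zero, ← ball_union_sphere] at hz
    rcases hz with hz | hz
    · intro h0
      have h1 := (hcmp z hz 1).1
      obtain ⟨c, hc, hconf⟩ := hmin.exists_inner_fderiv hz
      rw [hA z hz, norm_eq_sqrt_mul_of_inner hconf, h0] at h1
      simp only [norm_zero, norm_one, mul_one] at h1
      exact absurd h1 (not_le.2 (Real.sqrt_pos.2 hc))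
    · exact norm_pos_iff.1 (hm.trans_le (hbd z hz))
  have hgcl : DiffContOnCl ℂ g (ball 0 1) := ⟨hgd, by rwa [closure_ball _ one_ne_zero]⟩
  have hmg : m ≤ ‖g z‖ := by
    -- Since `g` has no zeros on the closed disk, the maximum principle for `1/g` is a minimum
    -- principle for `|g|`.
    have := Complex.norm_le_of_forall_mem_frontier_norm_le isBounded_ball (hgcl.inv hg0) (C := m⁻¹)
      (fun ζ hζ => by
        rw [frontier_ball _ one_ne_zero] at hζ
        rw [Pi.inv_apply, norm_inv]
        exact inv_anti₀ hm (hbd ζ hζ)) (subset_closure hz)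
    rw [Pi.inv_apply, norm_inv] at this
    exact (inv_le_inv₀ (norm_pos_iff.2 (hg0 z (subset_closure hz))) hm).1 this
  have h2 := (hcmp z hz v).2
  rw [hA z hz] at h2
  nlinarith [mul_le_mul_of_nonneg_right hmg (norm_nonneg v)]

/-! ### From the differential to the intrinsic distance. -/

/-- A lower bound for the stretching of `F` is a lower bound for its intrinsic distance. -/
theorem mul_dist_le_intrinsicDist {F : ℂ → E3} (hF : ContDiffOn ℝ 1 F (ball (0 : ℂ) 1)) {k : ℝ}
    (hk : ∀ z ∈ ball (0 : ℂ) 1, ∀ v, k * ‖v‖ ≤ ‖fderiv ℝ F z v‖) (hk0 : 0 ≤ k) {z w : ℂ}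
    (hz : z ∈ ball (0 : ℂ) 1) (hw : w ∈ ball (0 : ℂ) 1) :
    k * dist z w ≤ intrinsicDist F z w := by
  refine le_csInf ?_ ?_
  -- The straight segment shows that the infimum is over a nonempty set; a real `sInf` of the empty
  -- set would be 0.
  · let γ : ℝ → ℂ := fun t => z + t • (w - z)
    refine ⟨_, γ, ⟨?_, ?_, by simp [γ], by simp [γ]⟩, rfl⟩
    · exact ContDiff.contDiffOn (by simp only [γ]; fun_prop)
    · intro t ht
      exact (convex_ball (0 : ℂ) 1).segment_subset hz hw
        (by rw [segment_eq_image']; exact mem_image_of_mem _ ht)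
  rintro L ⟨γ, hγ, rfl⟩
  have hu : UniqueDiffOn ℝ (Icc (0 : ℝ) 1) := uniqueDiffOn_Icc one_pos
  have hγc := hγ.contDiffOn.continuousOn_derivWithin hu le_rfl
  have hcomp : ContDiffOn ℝ 1 (F ∘ γ) (Icc 0 1) := hF.comp hγ.contDiffOn hγ.mapsTo
  have hcc := hcomp.continuousOn_derivWithin hu le_rfl
  have hchain : ∀ t ∈ Icc (0 : ℝ) 1,
      derivWithin (F ∘ γ) (Icc 0 1) t = fderiv ℝ F (γ t) (derivWithin γ (Icc 0 1) t) := by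
    intro t ht
    have h1 : HasFDerivAt F (fderiv ℝ F (γ t)) (γ t) :=
      ((hF.contDiffAt (isOpen_ball.mem_nhds (hγ.mapsTo ht))).differentiableAt one_ne_zero).hasFDerivAt
    have h2 := (hγ.contDiffOn.differentiableOn one_ne_zero t ht).hasDerivWithinAt
    exact (h1.comp_hasDerivWithinAt t h2).derivWithin (hu t ht)
  have hint : ∫ t in (0 : ℝ)..1, derivWithin γ (Icc 0 1) t = w - z := by
    rw [← hγ.source, ← hγ.target]
    refine intervalIntegral.integral_eq_sub_of_hasDeriv_right_of_le zero_le_one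
      hγ.contDiffOn.continuousOn (fun t ht => ?_)
      (ContinuousOn.intervalIntegrable (by rwa [uIcc_of_le zero_le_one]))
    exact ((hγ.contDiffOn.differentiableOn one_ne_zero t
      (Ioo_subset_Icc_self ht)).hasDerivWithinAt.hasDerivAt (Icc_mem_nhds ht.1 ht.2)).hasDerivWithinAt
  calc k * dist z w = k * ‖∫ t in (0 : ℝ)..1, derivWithin γ (Icc 0 1) t‖ := by
        rw [hint, dist_eq_norm, norm_sub_rev]
    _ ≤ k * ∫ t in (0 : ℝ)..1, ‖derivWithin γ (Icc 0 1) t‖ := by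
        gcongr; exact intervalIntegral.norm_integral_le_integral_norm zero_le_one
    _ = ∫ t in (0 : ℝ)..1, k * ‖derivWithin γ (Icc 0 1) t‖ := by
        rw [intervalIntegral.integral_const_mul]
    _ ≤ surfaceLength F γ := by
        refine intervalIntegral.integral_mono_on zero_le_one
          (ContinuousOn.intervalIntegrable (by
            rw [uIcc_of_le zero_le_one]; exact continuousOn_const.mul hγc.norm))
          (ContinuousOn.intervalIntegrable (by rw [uIcc_of_le zero_le_one]; exact hcc.norm))
          (fun t ht => ?_)
        rw [hchain t ht]
        exact hk _ (hγ.mapsTo ht) _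

theorem mainTheorem5 (F : ℂ → E3)
    (hmin : IsConformalMinimalImmersion F)
    (hC1 : ContDiffOn ℝ 1 F (closedBall (0 : ℂ) 1))
    (hbdry : ∀ z ∈ sphere (0 : ℂ) 1, F z ∈ sphere (0 : E3) 1)
    (hnormal : NormalsInHalfSphere F) :
    (∀ z ∈ unitDisk, (1 / 2) * ((1 - ‖F 0‖) / (1 + ‖F 0‖)) ≤ ‖fderiv ℝ F z‖) ∧
      ‖F 0‖ < 1 ∧
      ∀ z ∈ unitDisk, ∀ w ∈ unitDisk,
        dist z w ≤ 2 * ((1 + ‖F 0‖) / (1 - ‖F 0‖)) * intrinsicDist F z w := by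
  have h0 : ‖F 0‖ < 1 := hmin.norm_lt_one
    (fun z hz => hmin.norm_le_one hC1.continuousOn hbdry z (ball_subset_closedBall hz))
    (mem_ball_self one_pos)
  have hp : 0 < 1 - ‖F 0‖ := by linarith
  have hp' : 0 < 1 + ‖F 0‖ := by positivity
  have key : ∀ z ∈ ball (0 : ℂ) 1, ∀ v : ℂ,
      1 / 2 * ((1 - ‖F 0‖) / (1 + ‖F 0‖)) * ‖v‖ ≤ ‖fderiv ℝ F z v‖ := fun z hz v =>
    hmin.le_conformalFactor hC1 hnormal (div_pos hp hp')
      (fun ζ hζ => hmin.boundary_schwarz hC1 hbdry hζ) hz v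
  refine ⟨fun z hz => ?_, h0, fun z hz w hw => ?_⟩
  · have h1 := key z hz 1
    have h2 := (fderiv ℝ F z).le_opNorm 1
    simp only [norm_one, mul_one] at h1 h2
    exact h1.trans h2
  · have h := mul_dist_le_intrinsicDist (hC1.mono ball_subset_closedBall) key (by positivity) hz hw
    have hC : 0 < 2 * ((1 + ‖F 0‖) / (1 - ‖F 0‖)) := by positivity
    calc dist z w = 2 * ((1 + ‖F 0‖) / (1 - ‖F 0‖))
          * (1 / 2 * ((1 - ‖F 0‖) / (1 + ‖F 0‖)) * dist z w) := by field_simp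
      _ ≤ _ := by gcongr
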